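/- Let $\mathcal G$ be a finite simple undirected graph with $n$ nodes and adjacency matrix $A\in\{0,1\}^{n\times n}$. Let $I$ be the identity matrix, $J$ the $n\times n$ matrix with zeros on the diagonal and ones elsewhere, $\mathbf 1$ the column vector of ones, $\odot$ the entrywise product, $\mathrm{diag}(v)$ the diagonal matrix with diagonal $v$, and, for a matrix $M$, let $(M>0)$ be the $0$-$1$ matrix marking the positive entries of $M$. Put \begin{align*} X_2 &= A^2\odot J,\\ X_3 &= A^3\odot J - A(A^2\odot I) - (A^2\odot I)A + A,\\ X_4 &= A^4\odot J - (A(A^2\odot I-2I)A)\odot J - (A^2\odot I)X_2 - X_2(A^2\odot I)\\ &\quad - A(A^3\odot I) - (A^3\odot I)A + 3\,A^2\odot A,\\ X_5 &= A^5\odot J - A(A^2\odot I)(A^2\odot I-I) - (A^2\odot I)A(A^2\odot I) - (A^2\odot I-I)(A^2\odot I)A\\ &\quad - (A(A^2\odot I-I)X_2)\odot J - (X_2(A^2\odot I-I)A)\odot J - (A^2\odot I)X_3 - X_3(A^2\odot I-I)\\ &\quad - (A^3\odot I)X_2 - X_2(A^3\odot I) - (A(A^3\odot I)A)\odot J - A\odot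 A^2\\ &\quad + 3\,(A(A\odot A^2)+(A\odot A^2)A)\odot J - A\,\mathrm{diag}((A\odot X_3)\mathbf 1) - \mathrm{diag}((A\odot X_3)\mathbf 1)\,A\\ &\quad + 3\,A\odot X_3 + 3\,A\odot A^2\odot(A^2-(A^2>0)). \end{align*} Each $\tfrac12\,\mathbf 1^{\mathsf T}X_l\mathbf 1$ is a sentence of the matrix language MATLANG, that is, a scalar-valued expression in the matrix variable $A$ that does not depend on the graph and is built with matrix product, transpose, $\mathbf 1$, $\mathrm{diag}$, $\odot$, addition, multiplication by real scalars and entrywise application of functions $\mathbb R\to\mathbb R$ (so $I=\mathrm{diag}(\mathbf 1)$ and $J=\mathbf 1\mathbf 1^{\mathsf T}-I$). Theorem. For every $l$ with $2\le l\le 5$, the sentence $\tfrac12\,\mathbf 1^{\mathsf T}X_l\mathbf 1$, evaluated on the adjacency matrix of $\mathcal G$, equals the number of $l$-paths in $\mathcal G$, that is, the number of subgraphs of $\mathcal G$ isomorphic to the path with $l$ edges and $l+1$ nodes. -/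

import Mathlib

namespace Matlang

/-- The two kinds of dimension of a MATLANG word: `one` (the number 1) and `node` (the size of the
input matrix, i.e. the number of nodes of the graph). -/
inductive Dim where
  | one
  | node

/-- The index set belonging to a dimension when the input matrix is indexed by `V`. -/
def Dim.Idx (V : Type*) : Dim → Type _
  | .one => PUnit
  | .node => V

instance (V : Type*) [Fintype V] : (d : Dim) → Fintype (d.Idx V)
  | .one => inferInstanceAs (Fintype PUnit)
  | .node => inferInstanceAs (Fintype V)

instance (V : Type*) [DecidableEq V] : (d : Dim) → DecidableEq (d.Idx V)
  | .one => inferInstanceAs (DecidableEq PUnit)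
  | .node => inferInstanceAs (DecidableEq V)

/-- Words of the matrix language MATLANG in one square matrix variable, with the operations
`·` (product), `ᵀ` (transpose), `𝟏` (column vector of ones), `diag`, `⊙` (entrywise product),
`+`, multiplication by real scalars, and entrywise application of functions `f`.
`Word a b` holds the words that produce an `a × b` matrix: `Word node node` square matrices,
`Word node one` column vectors, `Word one node` row vectors, `Word one one` scalars. -/
inductive Word : Dim → Dim → Type
  /-- the input matrix -/
  | input : Word .node .node
  | mul {a b c : Dim} : Word a b → Word b c → Word a c
  | transpose {a b : Dim} : Word a b → Word b a
  /-- the column vector of ones with as many entries as the argument has rows -/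
  | ones {a b : Dim} : Word a b → Word a .one
  | diag {a : Dim} : Word a .one → Word a a
  | had {a b : Dim} : Word a b → Word a b → Word a b
  | add {a b : Dim} : Word a b → Word a b → Word a b
  | smul {a b : Dim} : ℝ → Word a b → Word a b
  | map {a b : Dim} : (ℝ → ℝ) → Word a b → Word a b

/-- A sentence is a word that produces a scalar. -/
abbrev Sentence := Word .one .one

namespace Word

/-- The matrix that a word produces from the input matrix `M`. -/
def eval {V : Type*} [Fintype V] [DecidableEq V] (M : Matrix V V ℝ) :
    {a b : Dim} → Word a b → Matrix (a.Idx V) (b.Idx V) ℝ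
  | _, _, input => M
  | _, _, mul u v => eval M u * eval M v
  | _, _, transpose u => (eval M u).transpose
  | _, _, ones _ => Matrix.of fun _ _ => 1
  | _, _, diag u => Matrix.diagonal fun i => eval M u i PUnit.unit
  | _, _, had u v => Matrix.hadamard (eval M u) (eval M v)
  | _, _, add u v => eval M u + eval M v
  | _, _, smul c u => c • eval M u
  | _, _, map f u => (eval M u).map f

instance (a b : Dim) : Add (Word a b) := ⟨add⟩
instance (a b : Dim) : SMul ℝ (Word a b) := ⟨smul⟩
instance (a b : Dim) : Sub (Word a b) := ⟨fun u v => add u (smul (-1) v)⟩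
instance (a b c : Dim) : HMul (Word a b) (Word b c) (Word a c) := ⟨mul⟩

local infixl:72 " ⊙ " => Word.had

/-- The column vector of ones, indexed by the nodes. -/
def one : Word .node .one := ones input

/-- The adjacency matrix. -/
def A : Word .node .node := input

/-- The identity matrix. -/
def I : Word .node .node := diag one

/-- The matrix filled with ones except for the diagonal, which is zero. -/
def J : Word .node .node := one * transpose one - I

/-- The square of the adjacency matrix. -/
def A2 : Word .node .node := A * A

/-- The cube of the adjacency matrix. -/
def A3 : Word .node .node := A * A * A

/-- The 0-1 matrix that marks the positive entries of a matrix. -/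
noncomputable def pos (u : Word .node .node) : Word .node .node :=
  map (fun x => if 0 < x then 1 else 0) u

def X₂ : Word .node .node := A2 ⊙ J

noncomputable def X₃ : Word .node .node :=
  A3 ⊙ J - A * (A2 ⊙ I) - (A2 ⊙ I) * A + A

noncomputable def X₄ : Word .node .node :=
  (A * A * A * A) ⊙ J - (A * (A2 ⊙ I - (2 : ℝ) • I) * A) ⊙ J
    - (A2 ⊙ I) * X₂ - X₂ * (A2 ⊙ I)
    - A * (A3 ⊙ I) - (A3 ⊙ I) * A + (3 : ℝ) • (A2 ⊙ A)

noncomputable def X₅ : Word .node .node :=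
  (A * A * A * A * A) ⊙ J - A * (A2 ⊙ I) * (A2 ⊙ I - I)
    - (A2 ⊙ I) * A * (A2 ⊙ I) - (A2 ⊙ I - I) * (A2 ⊙ I) * A
    - (A * (A2 ⊙ I - I) * X₂) ⊙ J
    - (X₂ * (A2 ⊙ I - I) * A) ⊙ J
    - (A2 ⊙ I) * X₃ - X₃ * (A2 ⊙ I - I)
    - (A3 ⊙ I) * X₂ - X₂ * (A3 ⊙ I)
    - (A * (A3 ⊙ I) * A) ⊙ J - A ⊙ A2
    + (3 : ℝ) • ((A * (A ⊙ A2) + (A ⊙ A2) * A) ⊙ J)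
    - A * diag ((A ⊙ X₃) * one) - diag ((A ⊙ X₃) * one) * A
    + (3 : ℝ) • (A ⊙ X₃) + (3 : ℝ) • (A ⊙ A2 ⊙ (A2 - pos A2))

/-- The path counting words `X_l` for `2 ≤ l ≤ 5` (the value for other `l` is irrelevant). -/
noncomputable def X : ℕ → Word .node .node
  | 2 => X₂
  | 3 => X₃
  | 4 => X₄
  | 5 => X₅
  | _ => A

end Word

/-- The sentence `½ · 𝟏ᵀ X_l 𝟏`. -/
noncomputable def pathSentence (l : ℕ) : Sentence :=
  (1 / 2 : ℝ) • (Word.one.transpose * Word.X l * Word.one)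

/-- The real number that a sentence computes from the input matrix `M`. -/
def Sentence.value {V : Type*} [Fintype V] [DecidableEq V] (s : Sentence) (M : Matrix V V ℝ) : ℝ :=
  Word.eval M s PUnit.unit PUnit.unit

end Matlang

/-- The number of `l`-paths in `G`: the number of subgraphs of `G` that are isomorphic to the path
with `l` edges (and `l + 1` nodes). -/
noncomputable def SimpleGraph.numPaths {V : Type*} [Fintype V] (G : SimpleGraph V) (l : ℕ) : ℕ :=
  G.copyCount (SimpleGraph.pathGraph (l + 1))

/-! Entrywise, X_l(x, y) is the number of sequences of l + 1 distinct vertices from x to y with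
consecutive vertices adjacent, and 0 when x = y. The only automorphisms of a path with an edge are
the identity and the reversal, so each path subgraph comes from exactly two such sequences
(`labelledCopyCount_pathGraph`); this is the factor ½. The sequence count is a nested sum of
adjacency entries times indicators `neInd` for the non-consecutive pairs (`two_mul_numPaths_two` to
`two_mul_numPaths_five`). The indicators are removed one vertex at a time, from the innermost sum
outwards: excluding a vertex from a sum subtracts the summand at that vertex (`neInd.sum_mul`). The
remaining unrestricted sums are entries of powers of M or degree-weighted variants, simplified by
symmetry, zero diagonal and m² = m for entries m. The results, `sum_three_paths`, `sum_four_paths`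
and `sum_five_paths`, agree off the diagonal with the entries of the words. -/

/-! ### Path subgraphs and their two labellings. -/

namespace SimpleGraph

/-- An injective graph homomorphism from a path to itself is the identity or the reversal. -/
theorem pathGraph_injective_hom_eq {n : ℕ} (s : Fin (n + 1) → Fin (n + 1))
    (hs : Function.Injective s)
    (hadj : ∀ i j, (pathGraph (n + 1)).Adj i j → (pathGraph (n + 1)).Adj (s i) (s j)) :
    (∀ i, s i = i) ∨ ∀ i, s i = i.rev := by
  have step : ∀ k (hk : k + 1 < n + 1),
      (s ⟨k, by omega⟩).val + 1 = (s ⟨k + 1, hk⟩).val ∨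
      (s ⟨k + 1, hk⟩).val + 1 = (s ⟨k, by omega⟩).val := fun k hk =>
    pathGraph_adj.1 (hadj ⟨k, by omega⟩ ⟨k + 1, hk⟩ (pathGraph_adj.2 (Or.inl rfl)))
  rcases Nat.eq_zero_or_pos n with rfl | hn
  · exact Or.inl fun i => by omega
  have inj2 : ∀ k (hk : k + 2 < n + 1), (s ⟨k, by omega⟩).val ≠ (s ⟨k + 2, hk⟩).val := by
    intro k hk h
    have := hs (Fin.ext h)
    simp at this
  rcases step 0 (by omega) with h0 | h0
  -- Consecutive values differ by 1 and `inj2` forbids turning back, so the direction of the first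
  -- step persists.
  · left
    have key : ∀ k (hk : k + 1 < n + 1),
        (s ⟨k, by omega⟩).val + 1 = (s ⟨k + 1, hk⟩).val := by
      intro k
      induction k with
      | zero => intro _; exact h0
      | succ k ih =>
        intro hk
        have h1 := ih (by omega)
        have h2 : _ ≠ (s ⟨k + 1 + 1, hk⟩).val := inj2 k hk
        rcases step (k + 1) hk with h | h
        · exact h
        · omega
    have all : ∀ k (hk : k < n + 1), (s ⟨k, hk⟩).val = (s ⟨0, by omega⟩).val + k := by
      intro k
      induction k with
      | zero => intro _; rfl
      | succ k ih => intro hk; rw [← key k hk, ih (by omega)]; omega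
    -- n unit steps inside `Fin (n + 1)` leave 0 as the only possible start.
    have hl := all n (by omega)
    have hb := (s ⟨n, by omega⟩).isLt
    intro i
    ext
    have := all i.val i.isLt
    simp only [Fin.eta] at this
    omega
  · right
    have key : ∀ k (hk : k + 1 < n + 1),
        (s ⟨k + 1, hk⟩).val + 1 = (s ⟨k, by omega⟩).val := by
      intro k
      induction k with
      | zero => intro _; exact h0
      | succ k ih =>
        intro hk
        have h1 := ih (by omega)
        have h2 : _ ≠ (s ⟨k + 1 + 1, hk⟩).val := inj2 k hk
        rcases step (k + 1) hk with h | h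
        · omega
        · exact h
    have all : ∀ k (hk : k < n + 1), (s ⟨k, hk⟩).val + k = (s ⟨0, by omega⟩).val := by
      intro k
      induction k with
      | zero => intro _; rfl
      | succ k ih => intro hk; rw [← ih (by omega), ← key k hk]; omega
    have hl := all n (by omega)
    have hb := (s ⟨0, by omega⟩).isLt
    intro i
    ext
    have := all i.val i.isLt
    simp only [Fin.eta] at this
    rw [Fin.val_rev]
    omega

/-- The reversal of a path. -/
def pathGraphRev (n : ℕ) : pathGraph n ≃g pathGraph n where
  toEquiv := Fin.revPerm
  map_rel_iff' {i j} := by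
    simp only [pathGraph_adj, Fin.revPerm_apply, Fin.val_rev]
    omega

/-- Equal vertex sets provide the relabelling `s`; equal edge sets make it preserve adjacency. -/
theorem Copy.exists_comp_eq_of_toSubgraph_eq {V W : Type*} {H : SimpleGraph W} {G : SimpleGraph V}
    (f g : Copy H G) (h : g.toSubgraph = f.toSubgraph) :
    ∃ s : W → W, (∀ i, f (s i) = g i) ∧ Function.Injective s ∧
      ∀ i j, H.Adj i j → H.Adj (s i) (s j) := by
  have hv : ∀ i, ∃ j, f j = g i := by
    intro i
    have : g i ∈ g.toSubgraph.verts := ⟨i, trivial, rfl⟩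
    rw [h] at this
    obtain ⟨j, -, hj⟩ := this
    exact ⟨j, hj⟩
  choose s hs using hv
  refine ⟨s, hs, fun i j hij => g.injective ?_, fun i j hij => ?_⟩
  · change g i = g j
    rw [← hs, ← hs, hij]
  · have : g.toSubgraph.Adj (g i) (g j) := ⟨i, j, hij, rfl, rfl⟩
    rw [h, ← hs, ← hs] at this
    obtain ⟨a, b, hab, ha, hb⟩ := this
    rwa [← f.injective ha, ← f.injective hb]

theorem Copy.toSubgraph_comp_iso {V W : Type*} {H : SimpleGraph W} {G : SimpleGraph V}
    (f : Copy H G) (e : H ≃g H) : (f.comp e.toCopy).toSubgraph = f.toSubgraph := by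
  ext u v
  · simp only [Subgraph.map_verts, Subgraph.verts_top, Set.image_univ, Set.mem_range]
    constructor
    · rintro ⟨i, rfl⟩
      exact ⟨e i, rfl⟩
    · rintro ⟨i, rfl⟩
      exact ⟨e.symm i, congrArg f (e.apply_symm_apply i)⟩
  · constructor
    · rintro ⟨i, j, hij, rfl, rfl⟩
      exact ⟨e i, e j, e.map_rel_iff.2 hij, rfl, rfl⟩
    · rintro ⟨i, j, hij, rfl, rfl⟩
      exact ⟨e.symm i, e.symm j, e.symm.map_rel_iff.2 hij,
        congrArg f (e.apply_symm_apply i), congrArg f (e.apply_symm_apply j)⟩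

theorem labelledCopyCount_eq_natCard {V W : Type*} [Fintype V] [Fintype W] (G : SimpleGraph V)
    (H : SimpleGraph W) : G.labelledCopyCount H = Nat.card (Copy H G) :=
  (@Nat.card_eq_fintype_card _ (_)).symm

/-- Every path with at least one edge underlies exactly two labelled paths. -/
theorem labelledCopyCount_pathGraph {V : Type*} [Fintype V] (G : SimpleGraph V) (n : ℕ) :
    G.labelledCopyCount (pathGraph (n + 2)) = 2 * G.copyCount (pathGraph (n + 2)) := by
  classical
  let _ : Fintype {f : pathGraph (n + 2) →g G // Function.Injective f} := Fintype.ofFinite _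
  rw [labelledCopyCount_eq_natCard, copyCount_eq_card_image_copyToSubgraph,
    Nat.card_eq_fintype_card, ← Finset.card_univ, Finset.card_eq_sum_card_image Copy.toSubgraph,
    mul_comm, ← smul_eq_mul, ← Finset.sum_const]
  -- The fibre of `Copy.toSubgraph` over S consists of one copy f and its reversal, distinct because
  -- a path on n + 2 vertices has two different ends.
  refine Finset.sum_congr rfl fun S hS => ?_
  obtain ⟨f, -, rfl⟩ := Finset.mem_image.1 hS
  have hne : f ≠ f.comp (pathGraphRev (n + 2)).toCopy := by
    intro h
    have h1 : f 0 = f (Fin.rev 0) := congrArg (fun c : Copy _ _ => c 0) h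
    have h2 := congrArg Fin.val (f.injective h1)
    simp at h2
  refine Eq.trans ?_ (Finset.card_pair hne)
  congr 1
  ext g
  simp only [Finset.mem_filter, Finset.mem_univ, true_and, Finset.mem_insert,
    Finset.mem_singleton]
  constructor
  · intro h
    obtain ⟨s, hs, hinj, hadj⟩ := Copy.exists_comp_eq_of_toSubgraph_eq f g h
    rcases pathGraph_injective_hom_eq s hinj hadj with hid | hrev
    · left
      ext i
      rw [← hs, hid]
    · right
      ext i
      rw [← hs, hrev]
      rfl
  · rintro (rfl | rfl)
    · rfl
    · exact Copy.toSubgraph_comp_iso _ _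

/-- A labelled path is a sequence of distinct vertices in which neighbours are adjacent. -/
def pathCopyEquiv {V : Type*} (G : SimpleGraph V) (n : ℕ) :
    Copy (pathGraph (n + 1)) G ≃
      {f : Fin (n + 1) → V // Function.Injective f ∧ ∀ i : Fin n, G.Adj (f i.castSucc) (f i.succ)}
    where
  toFun c := ⟨c, c.injective, fun i => c.toHom.map_adj (pathGraph_adj.2 (Or.inl (by simp)))⟩
  invFun f := ⟨⟨f.1, by
    intro i j hij
    rcases pathGraph_adj.1 hij with h | h
    · have := f.2.2 ⟨i, by omega⟩
      rwa [show (⟨i, by omega⟩ : Fin n).succ = j from Fin.ext h] at this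
    · have := (f.2.2 ⟨j, by omega⟩).symm
      rwa [show (⟨j, by omega⟩ : Fin n).succ = i from Fin.ext h] at this⟩, f.2.1⟩
  left_inv _ := rfl
  right_inv _ := rfl

theorem labelledCopyCount_pathGraph_eq_sum {V : Type*} [Fintype V] [DecidableEq V]
    (G : SimpleGraph V) [DecidableRel G.Adj] (n : ℕ) :
    (G.labelledCopyCount (pathGraph (n + 1)) : ℝ) = ∑ f : Fin (n + 1) → V,
      if Function.Injective f ∧ ∀ i : Fin n, G.Adj (f i.castSucc) (f i.succ) then 1 else 0 := by
  rw [Finset.sum_boole, labelledCopyCount_eq_natCard,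
    Nat.card_congr (pathCopyEquiv G n), Nat.card_eq_fintype_card, Fintype.card_subtype]

end SimpleGraph

/-! ### Counts of vertex sequences as nested sums. -/

theorem Fin.sum_pi_succ {V M : Type*} [Fintype V] [AddCommMonoid M] (n : ℕ)
    (g : (Fin (n + 1) → V) → M) : ∑ f, g f = ∑ x, ∑ f : Fin n → V, g (Fin.cons x f) := by
  rw [← (Fin.consEquiv fun _ => V).sum_comp, Fintype.sum_prod_type]
  rfl

/-- The indicator of `x ≠ y`. -/
def neInd {V : Type*} [DecidableEq V] (x y : V) : ℝ := if x = y then 0 else 1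

namespace neInd

variable {V : Type*} [DecidableEq V]

theorem self (x : V) : neInd x x = 0 := if_pos rfl

theorem of_ne {x y : V} (h : x ≠ y) : neInd x y = 1 := if_neg h

theorem comm (x y : V) : neInd x y = neInd y x := by simp only [neInd, eq_comm]

end neInd

namespace SimpleGraph

theorem adj_cons_iff {V : Type*} (G : SimpleGraph V) {n : ℕ} (x : V) (f : Fin (n + 1) → V) :
    (∀ i : Fin (n + 1), G.Adj ((Fin.cons x f : Fin (n + 2) → V) i.castSucc)
      ((Fin.cons x f : Fin (n + 2) → V) i.succ)) ↔
    G.Adj x (f 0) ∧ ∀ i : Fin n, G.Adj (f i.castSucc) (f i.succ) := by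
  rw [Fin.forall_fin_succ]
  simp only [← Fin.succ_castSucc, Fin.cons_succ, Fin.castSucc_zero, Fin.cons_zero]

variable {V : Type*} [Fintype V] [DecidableEq V] (G : SimpleGraph V) [DecidableRel G.Adj]

/-- In this and the next three formulas, indicators occur only for non-consecutive vertices, since
adjacent ones are distinct anyway. The ends x, y are outermost, to match matrix entries, and each
indicator stands at the later-summed of its two vertices, where it can be eliminated. -/
theorem two_mul_numPaths_two : 2 * (G.numPaths 2 : ℝ) = ∑ x, ∑ y, neInd x y *
    ∑ a, G.adjMatrix ℝ x a * G.adjMatrix ℝ a y := by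
  have h := G.labelledCopyCount_pathGraph_eq_sum 2
  rw [labelledCopyCount_pathGraph] at h
  push_cast at h
  rw [numPaths, h]
  simp only [Fin.sum_pi_succ, Finset.univ_unique, Finset.sum_singleton, Finset.mul_sum]
  refine Finset.sum_congr rfl fun x _ => ?_
  rw [Finset.sum_comm]
  refine Finset.sum_congr rfl fun y _ => Finset.sum_congr rfl fun a _ => ?_
  simp only [Fin.cons_injective_iff, adj_cons_iff, Fin.cons_zero]
  by_cases h1 : G.Adj x a
  swap; · simp [h1]
  by_cases h2 : G.Adj a y
  swap; · simp [h2]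
  by_cases h3 : x = y
  · simp [h3, neInd]
  simp [h1, h2, h3, neInd, h1.ne, h2.ne, Function.injective_of_subsingleton]

theorem two_mul_numPaths_three : 2 * (G.numPaths 3 : ℝ) = ∑ x, ∑ y, neInd x y *
    ∑ a, G.adjMatrix ℝ x a * neInd y a * ∑ b, G.adjMatrix ℝ a b * G.adjMatrix ℝ b y *
      neInd x b := by
  have h := G.labelledCopyCount_pathGraph_eq_sum 3
  rw [labelledCopyCount_pathGraph] at h
  push_cast at h
  rw [numPaths, h]
  simp only [Fin.sum_pi_succ, Finset.univ_unique, Finset.sum_singleton, Finset.mul_sum]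
  refine Finset.sum_congr rfl fun x _ => ?_
  have reorder : ∀ F : V → V → V → ℝ,
      ∑ a, ∑ b, ∑ y, F a b y = ∑ y, ∑ a, ∑ b, F a b y := fun F =>
    (Finset.sum_congr rfl fun _ _ => Finset.sum_comm).trans Finset.sum_comm
  rw [reorder]
  refine Finset.sum_congr rfl fun y _ => Finset.sum_congr rfl fun a _ =>
    Finset.sum_congr rfl fun b _ => ?_
  simp only [Fin.cons_injective_iff, adj_cons_iff, Fin.cons_zero]
  by_cases h1 : G.Adj x a
  swap; · simp [h1]
  by_cases h2 : G.Adj a b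
  swap; · simp [h2]
  by_cases h3 : G.Adj b y
  swap; · simp [h3]
  by_cases e1 : x = b
  · simp [e1, neInd]
  by_cases e2 : x = y
  · simp [e2, neInd]
  by_cases e3 : a = y
  · simp [e3, neInd]
  simp [*, neInd, h1.ne, h2.ne, h3.ne, Ne.symm e3, Function.injective_of_subsingleton]

theorem two_mul_numPaths_four : 2 * (G.numPaths 4 : ℝ) = ∑ x, ∑ y, neInd x y *
    ∑ a, G.adjMatrix ℝ x a * neInd y a * ∑ c, G.adjMatrix ℝ c y * (neInd x c * neInd a c) *
      ∑ b, G.adjMatrix ℝ a b * G.adjMatrix ℝ b c * (neInd x b * neInd y b) := by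
  have h := G.labelledCopyCount_pathGraph_eq_sum 4
  rw [labelledCopyCount_pathGraph] at h
  push_cast at h
  rw [numPaths, h]
  simp only [Fin.sum_pi_succ, Finset.univ_unique, Finset.sum_singleton, Finset.mul_sum]
  -- A single permutation of quadruples moves the end y to the front and the middle vertex b to the
  -- innermost place.
  have reorder : ∀ F : V → V → V → V → ℝ,
      ∑ a, ∑ b, ∑ c, ∑ y, F a b c y = ∑ y, ∑ a, ∑ c, ∑ b, F a b c y := by
    intro F
    have := Fintype.sum_equiv
      (⟨fun p => (p.2.2.2, p.1, p.2.2.1, p.2.1), fun p => (p.2.1, p.2.2.2, p.2.2.1, p.1),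
        fun _ => rfl, fun _ => rfl⟩ : V × V × V × V ≃ V × V × V × V)
      (fun p => F p.1 p.2.1 p.2.2.1 p.2.2.2)
      (fun p => F p.2.1 p.2.2.2 p.2.2.1 p.1) (fun _ => rfl)
    simpa only [Fintype.sum_prod_type] using this
  refine Finset.sum_congr rfl fun x _ => ?_
  rw [reorder]
  refine Finset.sum_congr rfl fun y _ => Finset.sum_congr rfl fun a _ =>
    Finset.sum_congr rfl fun c _ => Finset.sum_congr rfl fun b _ => ?_
  simp only [Fin.cons_injective_iff, adj_cons_iff, Fin.cons_zero]
  by_cases h1 : G.Adj x a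
  swap; · simp [h1]
  by_cases h2 : G.Adj a b
  swap; · simp [h2]
  by_cases h3 : G.Adj b c
  swap; · simp [h3]
  by_cases h4 : G.Adj c y
  swap; · simp [h4]
  by_cases e1 : x = b
  · simp [e1, neInd]
  by_cases e2 : x = c
  · simp [e2, neInd]
  by_cases e3 : x = y
  · simp [e3, neInd]
  by_cases e4 : a = c
  · simp [e4, neInd]
  by_cases e5 : a = y
  · simp [e5, neInd]
  by_cases e6 : b = y
  · simp [e6, neInd]
  simp [*, neInd, h1.ne, h2.ne, h3.ne, h4.ne, Ne.symm e5, Ne.symm e6,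
    Function.injective_of_subsingleton]

theorem two_mul_numPaths_five : 2 * (G.numPaths 5 : ℝ) = ∑ x, ∑ y, neInd x y *
    ∑ a, G.adjMatrix ℝ x a * neInd y a * ∑ d, G.adjMatrix ℝ d y * (neInd x d * neInd a d) *
      ∑ b, G.adjMatrix ℝ a b * (neInd x b * neInd y b * neInd d b) *
        ∑ c, G.adjMatrix ℝ b c * G.adjMatrix ℝ c d *
          (neInd x c * neInd y c * neInd a c) := by
  have h := G.labelledCopyCount_pathGraph_eq_sum 5
  rw [labelledCopyCount_pathGraph] at h
  push_cast at h
  rw [numPaths, h]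
  simp only [Fin.sum_pi_succ, Finset.univ_unique, Finset.sum_singleton, Finset.mul_sum]
  have reorder : ∀ F : V → V → V → V → V → ℝ,
      ∑ a, ∑ b, ∑ c, ∑ d, ∑ y, F a b c d y = ∑ y, ∑ a, ∑ d, ∑ b, ∑ c, F a b c d y := by
    intro F
    have := Fintype.sum_equiv
      (⟨fun p => (p.2.2.2.2, p.1, p.2.2.2.1, p.2.1, p.2.2.1),
        fun p => (p.2.1, p.2.2.2.1, p.2.2.2.2, p.2.2.1, p.1), fun _ => rfl, fun _ => rfl⟩ :
        V × V × V × V × V ≃ V × V × V × V × V)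
      (fun p => F p.1 p.2.1 p.2.2.1 p.2.2.2.1 p.2.2.2.2)
      (fun p => F p.2.1 p.2.2.2.1 p.2.2.2.2 p.2.2.1 p.1) (fun _ => rfl)
    simpa only [Fintype.sum_prod_type] using this
  refine Finset.sum_congr rfl fun x _ => ?_
  rw [reorder]
  refine Finset.sum_congr rfl fun y _ => Finset.sum_congr rfl fun a _ =>
    Finset.sum_congr rfl fun d _ => Finset.sum_congr rfl fun b _ =>
    Finset.sum_congr rfl fun c _ => ?_
  simp only [Fin.cons_injective_iff, adj_cons_iff, Fin.cons_zero]
  by_cases h1 : G.Adj x a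
  swap; · simp [h1]
  by_cases h2 : G.Adj a b
  swap; · simp [h2]
  by_cases h3 : G.Adj b c
  swap; · simp [h3]
  by_cases h4 : G.Adj c d
  swap; · simp [h4]
  by_cases h5 : G.Adj d y
  swap; · simp [h5]
  by_cases e1 : x = b
  · simp [e1, neInd]
  by_cases e2 : x = c
  · simp [e2, neInd]
  by_cases e3 : x = d
  · simp [e3, neInd]
  by_cases e4 : x = y
  · simp [e4, neInd]
  by_cases e5 : a = c
  · simp [e5, neInd]
  by_cases e6 : a = d
  · simp [e6, neInd]
  by_cases e7 : a = y
  · simp [e7, neInd]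
  by_cases e8 : b = d
  · simp [e8, neInd]
  by_cases e9 : b = y
  · simp [e9, neInd]
  by_cases e10 : c = y
  · simp [e10, neInd]
  simp [*, neInd, h1.ne, h2.ne, h3.ne, h4.ne, h5.ne, Ne.symm e7, Ne.symm e8, Ne.symm e9,
    Ne.symm e10, Function.injective_of_subsingleton]

end SimpleGraph

/-! ### Entrywise values of the words. -/

namespace Matlang

open Matrix

section Diagonal

variable {W : Type*} [DecidableEq W]

theorem hadamard_one_eq_diagonal (B : Matrix W W ℝ) : B ⊙ 1 = diagonal fun x => B x x := by
  ext x y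
  rw [hadamard_apply, one_apply, diagonal_apply]
  split_ifs with h
  · rw [h, mul_one]
  · rw [mul_zero]

theorem diagonal_sub_smul_one (d : W → ℝ) (c : ℝ) :
    diagonal d - c • (1 : Matrix W W ℝ) = diagonal fun x => d x - c := by
  rw [← diagonal_one, ← diagonal_smul, diagonal_sub]
  simp

theorem diagonal_sub_one (d : W → ℝ) :
    diagonal d - (1 : Matrix W W ℝ) = diagonal fun x => d x - 1 := by
  rw [← diagonal_one, diagonal_sub]

end Diagonal

variable {V : Type*} [Fintype V] [DecidableEq V] (M : Matrix V V ℝ)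

namespace Word

theorem eval_sub {a b : Dim} (u v : Word a b) : eval M (u - v) = eval M u - eval M v := by
  rw [sub_eq_add_neg, ← neg_one_smul ℝ (eval M v)]
  rfl

/-- The matrix that a word of square shape produces. -/
def sq (u : Word .node .node) : Matrix V V ℝ := eval M u

theorem sq_add (u v : Word .node .node) : sq M (u + v) = sq M u + sq M v := rfl

theorem sq_sub (u v : Word .node .node) : sq M (u - v) = sq M u - sq M v := eval_sub M u v

theorem sq_mul (u v : Word .node .node) : sq M (u * v) = sq M u * sq M v := rfl

theorem sq_had (u v : Word .node .node) : sq M (had u v) = sq M u ⊙ sq M v := rfl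

theorem sq_smul (c : ℝ) (u : Word .node .node) : sq M (c • u) = c • sq M u := rfl

theorem sq_A : sq M A = M := rfl

theorem sq_A2 : sq M A2 = M * M := rfl

theorem sq_A3 : sq M A3 = M * M * M := rfl

theorem sq_I : sq M I = 1 := rfl

theorem sq_J : sq M J = Matrix.of neInd := by
  rw [J, sq_sub, sq_I]
  ext x y
  have h : sq M (one * transpose one) x y = 1 := by
    change ∑ _ : PUnit, (1 : ℝ) * 1 = 1
    simp
  rw [Matrix.sub_apply, h, Matrix.one_apply, Matrix.of_apply, neInd]
  split_ifs <;> norm_num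

theorem sq_diag_mul_one (u : Word .node .node) :
    sq M (diag (u * one)) = diagonal fun x => ∑ y, sq M u x y := by
  change diagonal _ = diagonal _
  congr 1
  ext x
  change ∑ y, sq M u x y * 1 = _
  simp

theorem sq_pos_A2 :
    sq M (pos A2) = Matrix.of fun x y => if 0 < (M * M) x y then 1 else 0 := rfl

end Word

theorem value_pathSentence (l : ℕ) :
    (pathSentence l).value M = 1 / 2 * ∑ x, ∑ y, Word.sq M (Word.X l) x y := by
  change 1 / 2 * ∑ y, (∑ x, 1 * Word.sq M (Word.X l) x y) * 1 = _
  simp only [one_mul, mul_one]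
  rw [Finset.sum_comm]

namespace Word

theorem sq_X₂_apply (x y : V) : sq M X₂ x y = neInd x y * (M * M) x y := by
  rw [X₂, sq_had, sq_J, sq_A2, hadamard_apply, mul_comm]
  rfl

theorem sq_X₃_apply (x y : V) : sq M X₃ x y = neInd x y * (M * M * M) x y -
    M x y * (M * M) y y - (M * M) x x * M x y + M x y := by
  simp only [X₃, sq_add, sq_sub, sq_had, sq_mul, sq_J, sq_I, sq_A, sq_A2, sq_A3,
    hadamard_one_eq_diagonal, Matrix.add_apply, Matrix.sub_apply, Matrix.mul_diagonal,
    Matrix.diagonal_mul, hadamard_apply, Matrix.of_apply]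
  ring

theorem sq_X₄_apply (x y : V) : sq M X₄ x y = neInd x y * (M * M * M * M) x y -
    neInd x y * ∑ a, M x a * ((M * M) a a - 2) * M a y - (M * M) x x * sq M X₂ x y
    - sq M X₂ x y * (M * M) y y - M x y * (M * M * M) y y - (M * M * M) x x * M x y
    + 3 * ((M * M) x y * M x y) := by
  simp only [X₄, sq_add, sq_sub, sq_had, sq_mul, sq_smul, sq_J, sq_I, sq_A, sq_A2, sq_A3,
    hadamard_one_eq_diagonal, diagonal_sub_smul_one, Matrix.add_apply, Matrix.sub_apply,
    Matrix.smul_apply, smul_eq_mul,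
    Matrix.mul_diagonal, Matrix.diagonal_mul, hadamard_apply, Matrix.of_apply]
  -- Only the product with a diagonal middle factor is expanded; powers of M stay closed.
  rw [Matrix.mul_apply (M := M * diagonal _)]
  simp only [Matrix.mul_diagonal]
  ring

theorem sq_X₅_apply (x y : V) : sq M X₅ x y = neInd x y * (M * M * M * M * M) x y
    - M x y * (M * M) y y * ((M * M) y y - 1)
    - (M * M) x x * M x y * (M * M) y y - ((M * M) x x - 1) * (M * M) x x * M x y
    - neInd x y * ∑ a, M x a * ((M * M) a a - 1) * sq M X₂ a y
    - neInd x y * ∑ a, sq M X₂ x a * ((M * M) a a - 1) * M a y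
    - (M * M) x x * sq M X₃ x y - sq M X₃ x y * ((M * M) y y - 1)
    - (M * M * M) x x * sq M X₂ x y - sq M X₂ x y * (M * M * M) y y
    - neInd x y * ∑ a, M x a * (M * M * M) a a * M a y - M x y * (M * M) x y
    + 3 * (neInd x y * (∑ a, M x a * (M a y * (M * M) a y) + ∑ a, M x a * (M * M) x a * M a y))
    - M x y * ∑ a, M y a * sq M X₃ y a - (∑ a, M x a * sq M X₃ x a) * M x y
    + 3 * (M x y * sq M X₃ x y)
    + 3 * (M x y * (M * M) x y * ((M * M) x y - if 0 < (M * M) x y then 1 else 0)) := by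
  simp only [X₅, sq_add, sq_sub, sq_had, sq_mul, sq_smul, sq_J, sq_I, sq_A, sq_A2, sq_A3,
    sq_diag_mul_one, sq_pos_A2, diagonal_mul_diagonal,
    hadamard_one_eq_diagonal, diagonal_sub_one, Matrix.add_apply, Matrix.sub_apply,
    Matrix.smul_apply, smul_eq_mul,
    Matrix.mul_diagonal, Matrix.diagonal_mul, hadamard_apply, Matrix.of_apply]
  rw [Matrix.mul_apply (M := M * diagonal _), Matrix.mul_apply (M := M * diagonal _),
    Matrix.mul_apply (M := sq M X₂ * diagonal _), Matrix.mul_apply (N := M ⊙ (M * M)),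
    Matrix.mul_apply (M := M ⊙ (M * M))]
  simp only [Matrix.mul_diagonal, hadamard_apply]
  ring

end Word

end Matlang

/-! ### Elimination of indicators; lengths three and four. -/

theorem Matrix.IsAdjMatrix.mul_self_apply {V : Type*} {M : Matrix V V ℝ} (hM : M.IsAdjMatrix)
    (x y : V) : M x y * M x y = M x y := by
  rcases hM.zero_or_one x y with h | h <;> simp [h]

namespace neInd

variable {V : Type*} [Fintype V] [DecidableEq V]

theorem sum_mul (F : V → ℝ) (x : V) : ∑ a, F a * neInd x a = ∑ a, F a - F x := by
  have h : ∀ a, F a * neInd x a = F a - if x = a then F a else 0 := fun a => by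
    unfold neInd
    split_ifs <;> ring
  simp [h]

/-- Distinctness of the excluded vertices ensures that no value is subtracted twice. -/
theorem sum_mul_two (F : V → ℝ) {x y : V} (hxy : x ≠ y) :
    ∑ a, F a * (neInd x a * neInd y a) = ∑ a, F a - F x - F y := by
  simp only [← mul_assoc]
  rw [sum_mul, sum_mul, of_ne hxy, mul_one]

theorem sum_mul_three (F : V → ℝ) {x y z : V} (hxy : x ≠ y) (hxz : x ≠ z) (hyz : y ≠ z) :
    ∑ a, F a * (neInd x a * neInd y a * neInd z a) = ∑ a, F a - F x - F y - F z := by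
  simp only [← mul_assoc]
  rw [sum_mul, sum_mul, sum_mul, of_ne hxy, of_ne hxz, of_ne hyz]
  ring

end neInd

namespace Matlang

open Matrix

variable {V : Type*} [Fintype V] {M : Matrix V V ℝ}

theorem mul_apply_comm (hM : M.IsAdjMatrix) (x y : V) : (M * M) x y = (M * M) y x := by
  simp only [Matrix.mul_apply]
  exact Finset.sum_congr rfl fun a _ => by rw [hM.symm.apply x a, hM.symm.apply a y, mul_comm]

theorem mul_mul_apply_eq (x y : V) : (M * M * M) x y = ∑ a, M x a * (M * M) a y := by
  rw [Matrix.mul_assoc, Matrix.mul_apply]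

theorem mul_mul_apply_comm (hM : M.IsAdjMatrix) (x y : V) :
    (M * M * M) x y = (M * M * M) y x := by
  rw [mul_mul_apply_eq, Matrix.mul_apply]
  exact Finset.sum_congr rfl fun a _ => by
    rw [hM.symm.apply a x, mul_apply_comm hM a y, mul_comm]

/-- Both sides are the degree of x. -/
theorem sum_apply_eq (hM : M.IsAdjMatrix) (x : V) : ∑ a, M x a = (M * M) x x := by
  rw [Matrix.mul_apply]
  exact Finset.sum_congr rfl fun a _ => by rw [hM.symm.apply x a, hM.mul_self_apply]

variable [DecidableEq V]

/-- From the walks x a b y, those with a = y and those with b = x are removed; the walk x y x y is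
removed twice, hence the final `+ M x y`. -/
theorem sum_three_paths (hM : M.IsAdjMatrix) (x y : V) :
    ∑ a, M x a * neInd y a * ∑ b, M a b * M b y * neInd x b =
      (M * M * M) x y - M x y * (M * M) y y - (M * M) x x * M x y + M x y := by
  have h : ∀ a, ∑ b, M a b * M b y * neInd x b = (M * M) a y - M a x * M x y := fun a => by
    rw [neInd.sum_mul, Matrix.mul_apply]
  have h' : ∀ a, M x a * neInd y a * ((M * M) a y - M a x * M x y) =
      (M x a * (M * M) a y - M x a * M a x * M x y) * neInd y a := fun a => by ring
  simp only [h, h']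
  rw [neInd.sum_mul, Finset.sum_sub_distrib, ← mul_mul_apply_eq, ← Finset.sum_mul,
    ← Matrix.mul_apply, hM.symm.apply x y]
  -- With m = `M x y`, the factor m + 1 turns m² = m into m³ = m.
  linear_combination (M x y + 1) * hM.mul_self_apply x y

theorem sum_four_paths (hM : M.IsAdjMatrix) {x y : V} (hxy : x ≠ y) :
    ∑ a, M x a * neInd y a * ∑ c, M c y * (neInd x c * neInd a c) *
      ∑ b, M a b * M b c * (neInd x b * neInd y b) =
    (M * M * M * M) x y - ∑ a, M x a * ((M * M) a a - 2) * M a y - (M * M) x x * (M * M) x y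
    - (M * M) x y * (M * M) y y - M x y * (M * M * M) y y - (M * M * M) x x * M x y
    + 3 * ((M * M) x y * M x y) := by
  have hK : ∀ a, ∑ c, M c y * ((M * M) a c - M a x * M x c - M a y * M y c) =
      (M * M * M) a y - M a x * (M * M) x y - M a y * (M * M) y y := fun a => by
    have h1 : ∑ c, M c y * ((M * M) a c) = (M * M * M) a y := by
      rw [Matrix.mul_apply]; exact Finset.sum_congr rfl fun _ _ => mul_comm _ _
    have h2 : ∀ u, ∑ c, M c y * (M a u * M u c) = M a u * (M * M) u y := fun u => by
      rw [Matrix.mul_apply, Finset.mul_sum]; exact Finset.sum_congr rfl fun _ _ => by ring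
    simp only [mul_sub, Finset.sum_sub_distrib, h1, h2]
  have hinner : ∀ a, M x a * neInd y a * ∑ c, M c y * (neInd x c * neInd a c) *
      ∑ b, M a b * M b c * (neInd x b * neInd y b) =
      M x a * ((M * M * M) a y - (M * M) x y - M a y * (M * M) y y
        - M x y * ((M * M) x a - M a y) - M a y * ((M * M) a a - 1 - M a y)) * neInd y a := by
    intro a
    -- If `M x a = 0` both sides vanish; otherwise x ≠ a, as needed to exclude both from the sum
    -- over c.
    rcases hM.zero_or_one x a with h0 | h0
    · simp [h0]
    have hxa : x ≠ a := by
      rintro rfl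
      simp [hM.apply_diag] at h0
    have hax : M a x = 1 := by rw [hM.symm.apply x a, h0]
    have h1 : ∀ c, M c y * (neInd x c * neInd a c) *
        ∑ b, M a b * M b c * (neInd x b * neInd y b) =
        M c y * ((M * M) a c - M a x * M x c - M a y * M y c) * (neInd x c * neInd a c) :=
      fun c => by rw [neInd.sum_mul_two _ hxy, ← Matrix.mul_apply]; ring
    simp only [h1]
    rw [neInd.sum_mul_two _ hxa, hK, hM.apply_diag, hax, h0, mul_apply_comm hM a x,
      hM.symm.apply x y, hM.symm.apply a y]
    rcases hM.zero_or_one x y with h2 | h2 <;> rcases hM.zero_or_one a y with h3 | h3 <;>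
      simp only [h2, h3] <;> ring
  simp only [hinner]
  have h1 : ∑ a, M x a * (M * M * M) a y = (M * M * M * M) x y := by
    rw [← Matrix.mul_apply, ← Matrix.mul_assoc, ← Matrix.mul_assoc]
  have h2 : ∑ a, M x a * (M * M) x y = (M * M) x x * (M * M) x y := by
    rw [← Finset.sum_mul, sum_apply_eq hM]
  have h3 : ∑ a, M x a * (M a y * (M * M) y y) = (M * M) x y * (M * M) y y := by
    rw [Matrix.mul_apply (i := x) (k := y), Finset.sum_mul]
    exact Finset.sum_congr rfl fun _ _ => by ring
  have h4 : ∑ a, M x a * (M x y * (M * M) x a) = (M * M * M) x x * M x y := by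
    rw [mul_mul_apply_eq, Finset.sum_mul]
    exact Finset.sum_congr rfl fun a _ => by rw [mul_apply_comm hM a x]; ring
  have h5 : ∑ a, M x a * (M x y * M a y) = (M * M) x y * M x y := by
    rw [Matrix.mul_apply, Finset.sum_mul]
    exact Finset.sum_congr rfl fun _ _ => by ring
  have h6 : ∑ a, M x a * (M a y * (M * M) a a) =
      ∑ a, M x a * ((M * M) a a - 2) * M a y + 2 * (M * M) x y := by
    rw [Matrix.mul_apply (i := x) (k := y), Finset.mul_sum, ← Finset.sum_add_distrib]
    exact Finset.sum_congr rfl fun _ _ => by ring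
  have h7 : ∑ a, M x a * (M a y * 1) = (M * M) x y := by
    simp only [mul_one, ← Matrix.mul_apply]
  have h8 : ∑ a, M x a * (M a y * M a y) = (M * M) x y := by
    simp only [hM.mul_self_apply, ← Matrix.mul_apply]
  rw [neInd.sum_mul]
  simp only [mul_sub, Finset.sum_sub_distrib, h1, h2, h3, h4, h5, h6, h7, h8, hM.apply_diag]
  linear_combination (M * M) x y * hM.mul_self_apply x y

end Matlang

/-! ### Length five: successive elimination of c, b, d and a. -/

namespace Matlang

open Matrix

variable {V : Type*} [Fintype V] [DecidableEq V] {M : Matrix V V ℝ}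

/-- The walks `a b c d` avoiding `x` and `y` in which `a ≠ c` and `b ≠ d`. -/
theorem sum_inner_paths (hM : M.IsAdjMatrix) {x y a d : V} (hxy : x ≠ y) (hxa : x ≠ a)
    (hya : y ≠ a) (hxd : x ≠ d) (hyd : y ≠ d) :
    ∑ b, M a b * (neInd x b * neInd y b * neInd d b) *
      ∑ c, M b c * M c d * (neInd x c * neInd y c * neInd a c) =
    (M * M * M) a d - (M * M) a x * M x d - (M * M) a y * M y d - (M * M) a a * M a d
    - M a x * ((M * M) x d - M x y * M y d - M x a * M a d)
    - M a y * ((M * M) y d - M y x * M x d - M y a * M a d)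
    - M a d * ((M * M) d d - M d x * M x d - M d y * M y d - M d a * M a d) := by
  have h : ∀ b, M a b * (neInd x b * neInd y b * neInd d b) *
      ∑ c, M b c * M c d * (neInd x c * neInd y c * neInd a c) =
      M a b * ((M * M) b d - M b x * M x d - M b y * M y d - M b a * M a d) *
        (neInd x b * neInd y b * neInd d b) := fun b => by
    rw [neInd.sum_mul_three _ hxy hxa hya, ← Matrix.mul_apply]
    ring
  simp only [h]
  -- The values at b = x, y, d become the last three lines of the right-hand side.
  rw [neInd.sum_mul_three _ hxy hxd hyd]
  simp only [mul_sub, Finset.sum_sub_distrib, ← mul_assoc, ← Finset.sum_mul, ← Matrix.mul_apply,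
    hM.apply_diag]
  ring

/-- The number of paths `a b c d y` that avoid a neighbour `x` of `a`. -/
theorem sum_last_edges (hM : M.IsAdjMatrix) {x y a : V} (hxy : x ≠ y) (hya : y ≠ a)
    (h0 : M x a = 1) :
    ∑ d, M d y * (neInd x d * neInd a d) *
      ∑ b, M a b * (neInd x b * neInd y b * neInd d b) *
        ∑ c, M b c * M c d * (neInd x c * neInd y c * neInd a c) =
    (M * M * M * M) a y - (M * M) x a * (M * M) x y - (M * M) a y * (M * M) y y
    - (M * M) a a * (M * M) a y - (M * M * M) x y + M x y * (M * M) y y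
    - M a y * (M * M * M) y y + M a y * M x y * (M * M) x y + M a y * (M * M) a y
    - ∑ d, M a d * (M * M) d d * M d y + ∑ d, M a d * M x d * M d y + 3 * (M * M) a y
    - M x y * ((M * M * M) x a - (M * M) a y - (M * M) a a - 2 * (M * M) x x + 4
      - M a y * (M * M) x y + M a y)
    - M a y * ((M * M * M) a a - 2 * (M * M) x a - 2 * (M * M) a y + 2 * M x y) := by
  have hxa : x ≠ a := by
    rintro rfl
    simp [hM.apply_diag] at h0
  have hax : M a x = 1 := by rw [hM.symm.apply x a, h0]
  -- `z d` is `M d y` times the formula of `sum_inner_paths`, reduced using 0-1 entries and `M x a =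
  -- 1`. It need not be the true count at d = x, where the indicator vanishes, but `z x` and `z a`
  -- are then the corrections subtracted.
  let z : V → ℝ := fun d => (M * M * M) a d * M d y - (M * M) x a * (M x d * M d y)
    - (M * M) a y * M d y - (M * M) a a * (M a d * M d y) - (M * M) x d * M d y
    + M x y * M d y + M a d * M d y - M a y * ((M * M) y d * M d y)
    + M a y * M x y * (M x d * M d y) + M a y * (M a d * M d y) - M a d * (M * M) d d * M d y
    + M a d * M x d * M d y + 2 * (M a d * M d y)
  have hz : ∀ d, M d y * (neInd x d * neInd a d) *
      ∑ b, M a b * (neInd x b * neInd y b * neInd d b) *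
        ∑ c, M b c * M c d * (neInd x c * neInd y c * neInd a c) =
      z d * (neInd x d * neInd a d) := by
    intro d
    rcases hM.zero_or_one d y with h1 | h1
    · simp [z, h1]
    have hyd : y ≠ d := by
      rintro rfl
      simp [hM.apply_diag] at h1
    by_cases hxd : x = d
    · simp [hxd, neInd.self]
    rw [sum_inner_paths hM hxy hxa hya hxd hyd, mul_apply_comm hM a x, hM.symm.apply x y,
      hM.symm.apply a y, hM.symm.apply a d, hM.symm.apply x d, hM.symm.apply d y]
    simp only [z, h1, h0, hax]
    rcases hM.zero_or_one a y with h2 | h2 <;> rcases hM.zero_or_one a d with h3 | h3 <;>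
      rcases hM.zero_or_one x d with h4 | h4 <;> simp only [h2, h3, h4] <;> ring
  simp only [hz]
  rw [neInd.sum_mul_two _ hxa]
  have hsum : ∑ d, z d = (M * M * M * M) a y - (M * M) x a * (M * M) x y
      - (M * M) a y * (M * M) y y - (M * M) a a * (M * M) a y - (M * M * M) x y
      + M x y * (M * M) y y - M a y * (M * M * M) y y + M a y * M x y * (M * M) x y
      + M a y * (M * M) a y - ∑ d, M a d * (M * M) d d * M d y + ∑ d, M a d * M x d * M d y
      + 3 * (M * M) a y := by
    have hdy : ∑ d, M d y = (M * M) y y := by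
      rw [← sum_apply_eq hM]
      exact Finset.sum_congr rfl fun d _ => hM.symm.apply y d
    simp only [z, Finset.sum_sub_distrib, Finset.sum_add_distrib, ← Finset.mul_sum,
      ← Matrix.mul_apply, hdy]
    ring
  rw [hsum]
  simp only [z, h0, hax, hM.apply_diag, mul_apply_comm hM y x, mul_apply_comm hM y a,
    mul_mul_apply_comm hM a x]
  rcases hM.zero_or_one x y with h2 | h2 <;> rcases hM.zero_or_one a y with h3 | h3 <;>
    simp only [h2, h3] <;> ring

end Matlang

namespace Matlang

open Matrix

variable {V : Type*} [Fintype V] [DecidableEq V] {M : Matrix V V ℝ}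

theorem sum_five_paths (hM : M.IsAdjMatrix) {x y : V} (hxy : x ≠ y) :
    ∑ a, M x a * neInd y a * ∑ d, M d y * (neInd x d * neInd a d) *
      ∑ b, M a b * (neInd x b * neInd y b * neInd d b) *
        ∑ c, M b c * M c d * (neInd x c * neInd y c * neInd a c) =
    (M * M * M * M * M) x y
    - ∑ a, M x a * (M * M) a a * (M * M) a y - ∑ a, (M * M) x a * (M * M) a a * M a y
    - (M * M) x x * ((M * M * M) x y - M x y * (M * M) y y)
    - (M * M * M) x y * (M * M) y y + 3 * (M * M * M) x y
    - (M * M * M) x x * (M * M) x y - (M * M) x y * (M * M * M) y y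
    - ∑ a, M x a * (M * M * M) a a * M a y
    + 3 * (∑ a, M x a * M a y * (M * M) a y + ∑ a, M x a * (M * M) x a * M a y)
    - M x y * ((M * M * M * M) y y - ∑ a, M y a * (M * M) a a - 2 * (M * M) y y * (M * M) y y)
    - M x y * ((M * M * M * M) x x - ∑ a, M x a * (M * M) a a - 2 * (M * M) x x * (M * M) x x)
    + M x y * (3 * (M * M * M) x y - 6 * (M * M) x x - 6 * (M * M) y y + 4
      + 3 * (M * M) x y * (M * M) x y - 4 * (M * M) x y) := by
  -- The right-hand side of `sum_last_edges`, extended to all a; `L y` is needed for the correction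
  -- at a = y.
  let L : V → ℝ := fun a =>
    (M * M * M * M) a y - (M * M) x a * (M * M) x y - (M * M) a y * (M * M) y y
    - (M * M) a a * (M * M) a y - (M * M * M) x y + M x y * (M * M) y y
    - M a y * (M * M * M) y y + M a y * M x y * (M * M) x y + M a y * (M * M) a y
    - ∑ d, M a d * (M * M) d d * M d y + ∑ d, M a d * M x d * M d y + 3 * (M * M) a y
    - M x y * ((M * M * M) x a - (M * M) a y - (M * M) a a - 2 * (M * M) x x + 4
      - M a y * (M * M) x y + M a y)
    - M a y * ((M * M * M) a a - 2 * (M * M) x a - 2 * (M * M) a y + 2 * M x y)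
  have hL : ∀ a, M x a * neInd y a * ∑ d, M d y * (neInd x d * neInd a d) *
      ∑ b, M a b * (neInd x b * neInd y b * neInd d b) *
        ∑ c, M b c * M c d * (neInd x c * neInd y c * neInd a c) =
      M x a * L a * neInd y a := by
    intro a
    rcases hM.zero_or_one x a with h0 | h0
    · simp [h0]
    by_cases hya : y = a
    · simp [hya, neInd.self]
    rw [sum_last_edges hM hxy hya h0]
    simp only [L]
    ring
  simp only [hL]
  rw [neInd.sum_mul]
  have e1 : ∑ a, M x a * (M * M * M * M) a y = (M * M * M * M * M) x y := by
    rw [← Matrix.mul_apply]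
    simp only [Matrix.mul_assoc]
  have e2 : ∀ u, ∑ a, M x a * (M * M) u a = (M * M * M) u x := fun u => by
    rw [Matrix.mul_apply]
    exact Finset.sum_congr rfl fun a _ => by rw [hM.symm.apply a x, mul_comm]
  have e3 : ∑ a, M x a * (M * M * M) x a = (M * M * M * M) x x := by
    rw [Matrix.mul_apply]
    exact Finset.sum_congr rfl fun a _ => by rw [hM.symm.apply a x, mul_comm]
  have e4 : ∑ a, M x a * ∑ d, M a d * (M * M) d d * M d y =
      ∑ a, (M * M) x a * (M * M) a a * M a y := by
    simp only [Finset.mul_sum]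
    rw [Finset.sum_comm]
    refine Finset.sum_congr rfl fun d _ => ?_
    rw [Matrix.mul_apply (i := x) (k := d), mul_assoc, Finset.sum_mul]
    exact Finset.sum_congr rfl fun a _ => by ring
  have e5 : ∑ a, M x a * ∑ d, M a d * M x d * M d y = ∑ a, M x a * (M * M) x a * M a y := by
    simp only [Finset.mul_sum]
    rw [Finset.sum_comm]
    refine Finset.sum_congr rfl fun d _ => ?_
    rw [Matrix.mul_apply (i := x) (k := d), Finset.mul_sum, Finset.sum_mul]
    exact Finset.sum_congr rfl fun a _ => by ring
  have e6 : ∑ d, M y d * M x d * M d y = (M * M) x y := by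
    rw [Matrix.mul_apply]
    refine Finset.sum_congr rfl fun d _ => ?_
    rw [hM.symm.apply y d]
    linear_combination M x d * hM.mul_self_apply y d
  have e7 : ∑ d, M y d * (M * M) d d * M d y = ∑ d, M y d * (M * M) d d := by
    refine Finset.sum_congr rfl fun d _ => ?_
    rw [hM.symm.apply y d]
    linear_combination (M * M) d d * hM.mul_self_apply y d
  have hs : ∑ a, M x a * L a = (M * M * M * M * M) x y - (M * M * M) x x * (M * M) x y
      - (M * M * M) x y * (M * M) y y - ∑ a, M x a * (M * M) a a * (M * M) a y
      - (M * M) x x * (M * M * M) x y + (M * M) x x * (M x y * (M * M) y y)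
      - (M * M) x y * (M * M * M) y y + M x y * (M * M) x y * (M * M) x y
      + 3 * ∑ a, M x a * M a y * (M * M) a y
      - ∑ a, (M * M) x a * (M * M) a a * M a y + 3 * ∑ a, M x a * (M * M) x a * M a y
      + 3 * (M * M * M) x y
      - M x y * ((M * M * M * M) x x - (M * M * M) x y - ∑ a, M x a * (M * M) a a
        - 2 * (M * M) x x * (M * M) x x + 4 * (M * M) x x - (M * M) x y * (M * M) x y
        + (M * M) x y)
      - ∑ a, M x a * (M * M * M) a a * M a y - 2 * M x y * (M * M) x y := by
    -- Factors independent of a are moved outside so that each sum has a form already evaluated.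
    have split : ∀ a, M x a * L a = M x a * (M * M * M * M) a y
        - M x a * (M * M) x a * (M * M) x y - M x a * (M * M) a y * (M * M) y y
        - M x a * (M * M) a a * (M * M) a y
        - M x a * ((M * M * M) x y - M x y * (M * M) y y)
        - M x a * M a y * ((M * M * M) y y - M x y * (M * M) x y)
        + 3 * (M x a * M a y * (M * M) a y)
        - M x a * ∑ d, M a d * (M * M) d d * M d y + M x a * ∑ d, M a d * M x d * M d y
        + 3 * (M x a * (M * M) a y)
        - M x y * (M x a * (M * M * M) x a) + M x y * (M x a * (M * M) a y)
        + M x y * (M x a * (M * M) a a) - M x a * (M x y * (4 - 2 * (M * M) x x))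
        + M x a * M a y * (M x y * ((M * M) x y - 1))
        - M x a * (M * M * M) a a * M a y + 2 * (M x a * (M * M) x a * M a y)
        - M x a * M a y * (2 * M x y) := fun a => by
      simp only [L]
      ring
    simp only [split, Finset.sum_sub_distrib, Finset.sum_add_distrib, ← Finset.mul_sum,
      ← Finset.sum_mul, e1, e2, e3, e4, e5, sum_apply_eq hM, ← Matrix.mul_apply,
      ← Matrix.mul_assoc]
    ring
  rw [hs]
  simp only [L, e6, e7, hM.apply_diag]
  rcases hM.zero_or_one x y with h | h <;> simp only [h] <;> ring

/-! ### Comparison with X₅, and vanishing diagonals. -/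

namespace Word

theorem sq_X₅_apply_of_ne (hM : M.IsAdjMatrix) {x y : V} (hxy : x ≠ y) : sq M X₅ x y =
    (M * M * M * M * M) x y
    - ∑ a, M x a * (M * M) a a * (M * M) a y - ∑ a, (M * M) x a * (M * M) a a * M a y
    - (M * M) x x * ((M * M * M) x y - M x y * (M * M) y y)
    - (M * M * M) x y * (M * M) y y + 3 * (M * M * M) x y
    - (M * M * M) x x * (M * M) x y - (M * M) x y * (M * M * M) y y
    - ∑ a, M x a * (M * M * M) a a * M a y
    + 3 * (∑ a, M x a * M a y * (M * M) a y + ∑ a, M x a * (M * M) x a * M a y)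
    - M x y * ((M * M * M * M) y y - ∑ a, M y a * (M * M) a a - 2 * (M * M) y y * (M * M) y y)
    - M x y * ((M * M * M * M) x x - ∑ a, M x a * (M * M) a a - 2 * (M * M) x x * (M * M) x x)
    + M x y * (3 * (M * M * M) x y - 6 * (M * M) x x - 6 * (M * M) y y + 4
      + 3 * (M * M) x y * (M * M) x y - 4 * (M * M) x y) := by
  have c1 : ∑ a, M x a * ((M * M) a a - 1) * sq M X₂ a y =
      ∑ a, M x a * (M * M) a a * (M * M) a y - (M * M * M) x y
        - M x y * ((M * M) y y - 1) * (M * M) y y := by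
    have h : ∀ a, M x a * ((M * M) a a - 1) * sq M X₂ a y =
        (M x a * (M * M) a a * (M * M) a y - M x a * (M * M) a y) * neInd y a := fun a => by
      rw [sq_X₂_apply, neInd.comm a y]
      ring
    simp only [h]
    rw [neInd.sum_mul, Finset.sum_sub_distrib, ← mul_mul_apply_eq]
    ring
  have c2 : ∑ a, sq M X₂ x a * ((M * M) a a - 1) * M a y =
      ∑ a, (M * M) x a * (M * M) a a * M a y - (M * M * M) x y
        - (M * M) x x * ((M * M) x x - 1) * M x y := by
    have h : ∀ a, sq M X₂ x a * ((M * M) a a - 1) * M a y =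
        ((M * M) x a * (M * M) a a * M a y - (M * M) x a * M a y) * neInd x a := fun a => by
      rw [sq_X₂_apply]
      ring
    simp only [h]
    rw [neInd.sum_mul, Finset.sum_sub_distrib, ← Matrix.mul_apply]
    ring
  have c3 : ∀ u, ∑ a, M u a * sq M X₃ u a = (M * M * M * M) u u - ∑ a, M u a * (M * M) a a
      - (M * M) u u * (M * M) u u + (M * M) u u := by
    intro u
    have h : ∀ a, M u a * sq M X₃ u a = (M * M * M) u a * M a u - M u a * (M * M) a a
        - M u a * (M * M) u u + M u a := fun a => by
      rw [sq_X₃_apply, hM.symm.apply u a]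
      -- The graph has no loops, so the mask J is redundant next to a factor M.
      have hn : M u a * neInd u a = M u a := by
        by_cases hua : u = a
        · rw [← hua, hM.apply_diag, zero_mul]
        · rw [neInd.of_ne hua, mul_one]
      linear_combination (M * M * M) u a * hn +
        (1 - (M * M) a a - (M * M) u u) * hM.mul_self_apply u a
    simp only [h, Finset.sum_sub_distrib, Finset.sum_add_distrib, ← Finset.sum_mul,
      ← Matrix.mul_apply, sum_apply_eq hM]
  -- As M² has nonnegative entries, A² ⊙ (A² − (A² > 0)) has entries t² − t, with t the number of
  -- common neighbours.
  have c4 : (M * M) x y * (if 0 < (M * M) x y then 1 else 0) = (M * M) x y := by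
    split_ifs with h
    · rw [mul_one]
    · have : 0 ≤ (M * M) x y := by
        rw [Matrix.mul_apply]
        refine Finset.sum_nonneg fun a _ => ?_
        rcases hM.zero_or_one x a with h1 | h1 <;> rcases hM.zero_or_one a y with h2 | h2 <;>
          simp [h1, h2]
      linarith
  rw [sq_X₅_apply, c1, c2, c3, c3, sq_X₂_apply, sq_X₃_apply, neInd.of_ne hxy]
  simp only [← mul_assoc]
  rcases hM.zero_or_one x y with h | h <;> simp only [h]
  · ring
  · linear_combination (-3) * c4

/-- Once X₂ and X₃ are expanded, every term has a factor `neInd x x` or `M x x`. -/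
theorem sq_X₅_apply_self (hM : M.IsAdjMatrix) (x : V) : sq M X₅ x x = 0 := by
  rw [sq_X₅_apply, sq_X₃_apply, sq_X₂_apply, neInd.self, hM.apply_diag]
  ring

theorem sq_X₄_apply_self (hM : M.IsAdjMatrix) (x : V) : sq M X₄ x x = 0 := by
  rw [sq_X₄_apply, sq_X₂_apply, neInd.self, hM.apply_diag]
  ring

theorem sq_X₃_apply_self (hM : M.IsAdjMatrix) (x : V) : sq M X₃ x x = 0 := by
  rw [sq_X₃_apply, neInd.self, hM.apply_diag]
  ring

end Word

end Matlang

theorem mainTheorem10 {V : Type*} [Fintype V] [DecidableEq V] (G : SimpleGraph V)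
    [DecidableRel G.Adj] (l : ℕ) (hl₂ : 2 ≤ l) (hl₅ : l ≤ 5) :
    Matlang.Sentence.value (Matlang.pathSentence l) (G.adjMatrix ℝ) = (G.numPaths l : ℝ) := by
  have hM : (G.adjMatrix ℝ).IsAdjMatrix := G.isAdjMatrix_adjMatrix ℝ
  suffices h : ∑ x, ∑ y, Matlang.Word.sq (G.adjMatrix ℝ) (Matlang.Word.X l) x y =
      2 * (G.numPaths l : ℝ) by
    rw [Matlang.value_pathSentence, h]
    ring
  interval_cases l
  · rw [G.two_mul_numPaths_two]
    refine Finset.sum_congr rfl fun x _ => Finset.sum_congr rfl fun y _ => ?_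
    exact Matlang.Word.sq_X₂_apply _ x y
  · rw [G.two_mul_numPaths_three]
    refine Finset.sum_congr rfl fun x _ => Finset.sum_congr rfl fun y _ => ?_
    by_cases hxy : x = y
    · subst hxy
      rw [neInd.self, zero_mul]
      exact Matlang.Word.sq_X₃_apply_self hM x
    · rw [Matlang.sum_three_paths hM, neInd.of_ne hxy, one_mul]
      refine (Matlang.Word.sq_X₃_apply _ x y).trans ?_
      rw [neInd.of_ne hxy, one_mul]
  · rw [G.two_mul_numPaths_four]
    refine Finset.sum_congr rfl fun x _ => Finset.sum_congr rfl fun y _ => ?_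
    by_cases hxy : x = y
    · subst hxy
      rw [neInd.self, zero_mul]
      exact Matlang.Word.sq_X₄_apply_self hM x
    · rw [Matlang.sum_four_paths hM hxy, neInd.of_ne hxy, one_mul]
      refine (Matlang.Word.sq_X₄_apply _ x y).trans ?_
      rw [Matlang.Word.sq_X₂_apply, neInd.of_ne hxy, one_mul, one_mul, one_mul]
  · rw [G.two_mul_numPaths_five]
    refine Finset.sum_congr rfl fun x _ => Finset.sum_congr rfl fun y _ => ?_
    by_cases hxy : x = y
    · subst hxy
      rw [neInd.self, zero_mul]
      exact Matlang.Word.sq_X₅_apply_self hM x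
    · rw [Matlang.sum_five_paths hM hxy, neInd.of_ne hxy, one_mul]
      exact Matlang.Word.sq_X₅_apply_of_ne hM hxy
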